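/- Let $n\ge 1$, $A=\{1,\dots,n\}$, let $\Delta_n\subset\mathbb{R}^n$ be the probability simplex, and let $K\ge 0$. Let $\epsilon=(\epsilon^{(1)},\dots,\epsilon^{(n)})$ be an integrable random vector such that (1) $\epsilon$ has zero mean, and its law is absolutely continuous with respect to Lebesgue measure and has support $\mathbb{R}^n$; (2) for all $i\ne j$ the difference $\epsilon^{(j)}-\epsilon^{(i)}$ has a finite-valued density $g_{i,j}$ that attains its maximum at a point $\bar z_{i,j}\in\mathbb{R}$ (a mode). Let $E(u)=\mathbb{E}\big[\max_{i\in A}\{u^{(i)}+\epsilon^{(i)}\}\big]$ for $u\in\mathbb{R}^n$, let $\tilde E(U;\eta)=\eta\,E(U/\eta)$ for $\eta>0$, and let $L=2\sum_{i=1}^n\sum_{j\ne i}g_{i,j}(\bar z_{i,j})$. Suppose that $\mathbb{E}\big[\max_{i\in A}\epsilon^{(i)}\big]\le\alpha$. Consider the following algorithm. Set $U_0=0$ and $x_0=\frac1n(1,\dots,1)$. In round $t=1,2,\dots$ play $x_t=\nabla\tilde E(U_{t-1};\eta)$ (the gradient in the variable $U$), then observe an arbitrary reward vector $u_t\in\mathbb{R}^n$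 with $\|u_t\|_\infty\le K$, receive $\langle u_t,x_t\rangle$, and set $U_t=U_{t-1}+u_t$. Its regret after $T$ rounds is $$R_T=\max_{x\in\Delta_n}\langle x,U_T\rangle-\sum_{t=1}^T\langle x_t,u_t\rangle .$$ Then the algorithm is well defined: $E$ is differentiable, and $x_t\in\Delta_n$ for all $t$. Moreover: (a) For every $T\ge 1$, every $\eta>0$ and all such reward vectors $u_1,\dots,u_T$, $$R_T\le \eta\,\alpha+\frac{L K^2 T}{\eta}.$$ (b) For every $T\ge 1$ there is a step size $\eta_T>0$, not depending on the reward vectors, such that the algorithm run with $\eta=\eta_T$ satisfies, for all such reward vectors $u_1,\dots,u_T$, $$R_T\le 2K\sqrt{\alpha L T}.$$ If $n\ge 2$ and $K>0$, one may take the minimizer $\eta_T=K\sqrt{LT/\alpha}$ of the right-hand side of (a) over $\eta>0$. With these step sizes the algorithm is Hannan-consistent: for every $\delta>0$ there is $T_0$ such that $R_T/T\le\delta$ for all $T\ge T_0$ and all such reward vectors $u_1,\dots,u_T$. -/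

import Mathlib

open MeasureTheory Filter

noncomputable section

namespace RUMExperts

/-- The maximum of the coordinates of a vector indexed by the nonempty set of alternatives. -/
def maxCoord {n : ℕ} [NeZero n] (v : Fin n → ℝ) : ℝ :=
  Finset.univ.sup' Finset.univ_nonempty v

/-- The simplex `Δ_n`. -/
def simplex (n : ℕ) : Set (EuclideanSpace ℝ (Fin n)) :=
  {p | (∀ i, 0 ≤ p i) ∧ ∑ i, p i = 1}

/-- The norm `‖u‖_∞ = max_i |u i|` (the norm of the underlying function `Fin n → ℝ`). -/
def supNorm {n : ℕ} (u : EuclideanSpace ℝ (Fin n)) : ℝ := ‖(WithLp.ofLp u : Fin n → ℝ)‖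

/-- The random errors form an integrable random vector with zero mean, whose law is absolutely
continuous with respect to Lebesgue measure and fully supported on `ℝⁿ`. -/
structure RegularErrors {Ω : Type*} [MeasurableSpace Ω] (P : Measure Ω) {n : ℕ}
    (ε : Ω → EuclideanSpace ℝ (Fin n)) : Prop where
  aemeasurable : AEMeasurable ε P
  integrable : ∀ i, Integrable (fun ω => ε ω i) P
  mean_zero : ∀ i, ∫ ω, ε ω i ∂P = 0
  absolutelyContinuous : P.map ε ≪ volume
  full_support : (P.map ε).support = Set.univ

/-- `g` is a (finite-valued) probability density function of the real random variable `X`. -/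
structure IsDensityOf {Ω : Type*} [MeasurableSpace Ω] (P : Measure Ω) (X : Ω → ℝ)
    (g : ℝ → ℝ) : Prop where
  measurable : Measurable g
  nonneg : ∀ z, 0 ≤ g z
  map_eq : P.map X = volume.withDensity (fun z => ENNReal.ofReal (g z))

/-- A mode of a density: a real point at which the density attains its maximum. -/
def IsMode (g : ℝ → ℝ) (z : ℝ) : Prop := ∀ y, g y ≤ g z

/-- The surplus function `E(u) = 𝔼[max_i (u i + ε i)]`. -/
def surplus {Ω : Type*} [MeasurableSpace Ω] (P : Measure Ω) {n : ℕ} [NeZero n]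
    (ε : Ω → EuclideanSpace ℝ (Fin n)) (u : EuclideanSpace ℝ (Fin n)) : ℝ :=
  ∫ ω, maxCoord (fun i => u i + ε ω i) ∂P

/-- The perspective `U ↦ η * E (U / η)`. -/
def perspective {n : ℕ} (E : EuclideanSpace ℝ (Fin n) → ℝ) (η : ℝ)
    (U : EuclideanSpace ℝ (Fin n)) : ℝ :=
  η * E (η⁻¹ • U)

/-- The cumulative reward vector `U_t = u_1 + ... + u_t`, with `U_0 = 0`. -/
def cumReward {n : ℕ} (u : ℕ → EuclideanSpace ℝ (Fin n)) : ℕ → EuclideanSpace ℝ (Fin n)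
  | 0 => 0
  | t + 1 => cumReward u t + u (t + 1)

/-- The decisions of the gradient-based algorithm with potential `E` and step size `η` against the
reward vectors `u_1, u_2, ...`: `x_0` is uniform and `x_t` is the gradient of the perspective of
`E` at `U_{t-1}` for `t ≥ 1`. -/
def decision {n : ℕ} (E : EuclideanSpace ℝ (Fin n) → ℝ) (η : ℝ)
    (u : ℕ → EuclideanSpace ℝ (Fin n)) : ℕ → EuclideanSpace ℝ (Fin n)
  | 0 => WithLp.toLp 2 (fun _ => 1 / (n : ℝ))
  | t + 1 => gradient (perspective E η) (cumReward u t)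

/-- The regret over `T` rounds of the decisions `x_1, ..., x_T` against `u_1, ..., u_T`:
`max_{x ∈ Δ_n} ⟪x, U_T⟫ - ∑_{t=1}^T ⟪x_t, u_t⟫`
(the maximum of a linear function over a compact set, written as a supremum). -/
def regret {n : ℕ} (x u : ℕ → EuclideanSpace ℝ (Fin n)) (T : ℕ) : ℝ :=
  sSup ((fun p => inner ℝ p (cumReward u T)) '' simplex n)
    - ∑ t ∈ Finset.Icc 1 T, inner ℝ (x t) (u t)

/-- The constant `2 * ∑_i ∑_{j ≠ i} g_{i,j}(z_{i,j})`. -/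
def smoothConst {n : ℕ} (g : Fin n → Fin n → ℝ → ℝ) (z : Fin n → Fin n → ℝ) : ℝ :=
  2 * ∑ i, ∑ j ∈ Finset.univ.erase i, g i j (z i j)

/-- The reward vectors `u_1, ..., u_T` satisfy `‖u_t‖_∞ ≤ K`. -/
def BoundedRewards {n : ℕ} (K : ℝ) (T : ℕ) (u : ℕ → EuclideanSpace ℝ (Fin n)) : Prop :=
  ∀ t ∈ Finset.Icc 1 T, supNorm (u t) ≤ K

end RUMExperts

end

noncomputable section

namespace RUMExperts

/-! The surplus `E` is a smooth potential with an explicit quadratic upper bound. Let `p(u)` be the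
vector of choice probabilities. Keeping the alternative chosen at `u` gives `E(u+d) ≥ E(u) + ⟪p(u),
d⟫` (`add_inner_le_surplus`). In the other direction, if `‖d‖_∞ ≤ D`, a switch from `i` to `j` gains
at most `2D` minus the lead of `i` over `j`. Since the density of each error difference is bounded
by its value at the mode, integrating this triangular gain yields `E(u+d) ≤ E(u) + ⟪p(u), d⟫ + L D²`
(`surplus_add_le`). The two bounds together give `∇E = p`.

For the regret, the perspective of `E` at `U_t` grows per round by at most the reward received plus
`η L (K/η)² = L K²/η`. It starts at `η E(0) ≤ η α` and dominates every coordinate of `U_T`, because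
the errors have zero mean. Part (b) optimizes over `η`. -/

/-! ### Maximum and argmax of a vector. -/

theorem le_maxCoord {n : ℕ} [NeZero n] (v : Fin n → ℝ) (i : Fin n) :
    v i ≤ maxCoord v :=
  Finset.le_sup' v (Finset.mem_univ i)

theorem maxCoord_le {n : ℕ} [NeZero n] {v : Fin n → ℝ} {c : ℝ} (h : ∀ i, v i ≤ c) :
    maxCoord v ≤ c :=
  Finset.sup'_le _ _ fun i _ => h i

theorem exists_eq_maxCoord {n : ℕ} [NeZero n] (v : Fin n → ℝ) : ∃ i, maxCoord v = v i := by
  obtain ⟨i, -, hi⟩ := Finset.exists_mem_eq_sup' Finset.univ_nonempty v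
  exact ⟨i, hi⟩

theorem measurable_maxCoord {n : ℕ} [NeZero n] : Measurable (maxCoord (n := n)) := by
  have h := Finset.measurable_sup' (s := (Finset.univ : Finset (Fin n))) Finset.univ_nonempty
    (f := fun i (v : Fin n → ℝ) => v i) fun i _ => measurable_pi_apply i
  convert h using 1
  ext v
  simp [maxCoord, Finset.sup'_apply]

theorem abs_maxCoord_le {n : ℕ} [NeZero n] (v : Fin n → ℝ) : |maxCoord v| ≤ ∑ i, |v i| := by
  obtain ⟨i, hi⟩ := exists_eq_maxCoord v
  rw [hi]
  exact Finset.single_le_sum (f := fun i => |v i|) (fun j _ => abs_nonneg _) (Finset.mem_univ i)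

theorem maximizers_nonempty {n : ℕ} [NeZero n] (v : Fin n → ℝ) :
    (Finset.univ.filter fun i => maxCoord v = v i).Nonempty := by
  obtain ⟨i, hi⟩ := exists_eq_maxCoord v
  exact ⟨i, by simpa using hi⟩

/-- The smallest index of a maximal coordinate. -/
def argmax {n : ℕ} [NeZero n] (v : Fin n → ℝ) : Fin n :=
  (Finset.univ.filter fun i => maxCoord v = v i).min' (maximizers_nonempty v)

theorem apply_argmax {n : ℕ} [NeZero n] (v : Fin n → ℝ) : v (argmax v) = maxCoord v := by
  have h := Finset.min'_mem _ (maximizers_nonempty v)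
  exact ((Finset.mem_filter.1 h).2).symm

theorem argmax_eq_iff {n : ℕ} [NeZero n] (v : Fin n → ℝ) (i : Fin n) :
    argmax v = i ↔ maxCoord v = v i ∧ ∀ j, maxCoord v = v j → i ≤ j := by
  rw [argmax, Finset.min'_eq_iff]
  simp

/-- Breaking ties by index makes the choice single-valued and measurable, so ties never have to be
shown negligible. -/
theorem measurable_argmax {n : ℕ} [NeZero n] : Measurable (argmax (n := n)) := by
  refine measurable_to_countable' fun i => ?_
  have h : argmax ⁻¹' {i} =
      {v : Fin n → ℝ | maxCoord v = v i} ∩ ⋂ j, {v | maxCoord v = v j → i ≤ j} := by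
    ext v
    simp [argmax_eq_iff]
  have hm : ∀ j, MeasurableSet {v : Fin n → ℝ | maxCoord v = v j} := fun j =>
    measurableSet_eq_fun measurable_maxCoord (measurable_pi_apply j)
  rw [h]
  refine (hm i).inter (MeasurableSet.iInter fun j => ?_)
  by_cases hij : i ≤ j
  · simp [hij]
  · simp only [hij, imp_false]
    exact (hm j).compl

/-! ### The switching gain, pointwise and in expectation. -/

/-- The triangular kernel bounding the gain from switching to an alternative trailing by `s`. -/
def switchGain (b s : ℝ) : ℝ := (Set.Icc 0 b).indicator (fun s => b - s) s

theorem switchGain_nonneg (b s : ℝ) : 0 ≤ switchGain b s :=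
  Set.indicator_nonneg (fun _ hx => sub_nonneg.2 hx.2) s

theorem integrable_switchGain (b : ℝ) : Integrable (switchGain b) := by
  have h : IntegrableOn (fun s : ℝ => b - s) (Set.Icc 0 b) :=
    (continuous_const.sub continuous_id).continuousOn.integrableOn_compact isCompact_Icc
  exact (integrable_indicator_iff measurableSet_Icc).2 h

theorem integral_switchGain {b : ℝ} (hb : 0 ≤ b) : ∫ s, switchGain b s = b ^ 2 / 2 := by
  have h : ∫ s, switchGain b s = ∫ s in Set.Icc 0 b, (b - s) :=
    integral_indicator measurableSet_Icc
  rw [h, integral_Icc_eq_integral_Ioc, ← intervalIntegral.integral_of_le hb,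
    intervalIntegral.integral_sub intervalIntegrable_const intervalIntegral.intervalIntegrable_id,
    integral_id, intervalIntegral.integral_const, smul_eq_mul]
  ring

theorem map_le_smul_volume {Ω : Type*} [MeasurableSpace Ω] {P : Measure Ω} {X : Ω → ℝ}
    {g : ℝ → ℝ} (hg : IsDensityOf P X g) {M : ℝ} (hM : ∀ y, g y ≤ M) :
    P.map X ≤ ENNReal.ofReal M • (volume : Measure ℝ) := by
  rw [hg.map_eq, ← withDensity_const]
  exact withDensity_mono (Eventually.of_forall fun y => ENNReal.ofReal_le_ofReal (hM y))

theorem integrable_switchGain_comp {Ω : Type*} [MeasurableSpace Ω] {P : Measure Ω} {X : Ω → ℝ}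
    (hX : AEMeasurable X P) {g : ℝ → ℝ} (hg : IsDensityOf P X g) {M : ℝ} (hM : ∀ y, g y ≤ M)
    (b c : ℝ) : Integrable (fun ω => switchGain b (c - X ω)) P := by
  have h1 : Integrable (fun x => switchGain b (c - x)) (ENNReal.ofReal M • volume) :=
    ((integrable_switchGain b).comp_sub_left c).smul_measure ENNReal.ofReal_ne_top
  exact (h1.mono_measure (map_le_smul_volume hg hM)).comp_aemeasurable hX

/-- The law of `X` is at most `M` times Lebesgue measure, which is invariant under `x ↦ c - x`;
hence the bound does not depend on `c`. -/
theorem integral_switchGain_comp_le {Ω : Type*} [MeasurableSpace Ω] {P : Measure Ω} {X : Ω → ℝ}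
    (hX : AEMeasurable X P) {g : ℝ → ℝ} (hg : IsDensityOf P X g) {M : ℝ} (hM : ∀ y, g y ≤ M)
    {b : ℝ} (hb : 0 ≤ b) (c : ℝ) :
    ∫ ω, switchGain b (c - X ω) ∂P ≤ M * (b ^ 2 / 2) := by
  have h1 : Integrable (fun x => switchGain b (c - x)) (ENNReal.ofReal M • volume) :=
    ((integrable_switchGain b).comp_sub_left c).smul_measure ENNReal.ofReal_ne_top
  have hle := map_le_smul_volume hg hM
  have h2 : ∫ ω, switchGain b (c - X ω) ∂P = ∫ x, switchGain b (c - x) ∂(P.map X) :=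
    (integral_map (f := fun x => switchGain b (c - x)) hX (h1.mono_measure hle).1).symm
  rw [h2]
  refine (integral_mono_measure hle (Eventually.of_forall fun x => switchGain_nonneg _ _)
    h1).trans_eq ?_
  rw [integral_smul_measure, ENNReal.toReal_ofReal ((hg.nonneg 0).trans (hM 0)),
    integral_sub_left_eq_self (switchGain b) volume c, integral_switchGain hb, smul_eq_mul]

/-- Against the maximizer `i` of `w`, perturbing by `d` gains at most the switching gains. -/
theorem maxCoord_add_le {n : ℕ} [NeZero n] (w d : Fin n → ℝ) {D : ℝ} (hd : ∀ i, |d i| ≤ D) :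
    maxCoord (fun i => w i + d i) ≤ maxCoord w + d (argmax w)
      + ∑ i, ∑ j ∈ Finset.univ.erase i, switchGain (2 * D) (w i - w j) := by
  set k := argmax w with hk
  have hpos : ∀ i, 0 ≤ ∑ j ∈ Finset.univ.erase i, switchGain (2 * D) (w i - w j) := fun i =>
    Finset.sum_nonneg fun j _ => switchGain_nonneg _ _
  refine maxCoord_le fun j => ?_
  have hw : w k = maxCoord w := apply_argmax w
  have hj : w j ≤ w k := hw ▸ le_maxCoord w j
  have h1 := abs_le.1 (hd j)
  have h2 := abs_le.1 (hd k)
  by_cases hjk : j = k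
  · have := Finset.sum_nonneg fun i (_ : i ∈ Finset.univ) => hpos i
    rw [← hw, hjk]
    linarith
  -- Only the pair `(k, j)` of the double sum is needed: `j` overtakes `k` by at most `d j - d k ≤
  -- 2D` minus its deficit.
  · have h3 : switchGain (2 * D) (w k - w j) ≤
        ∑ i, ∑ j ∈ Finset.univ.erase i, switchGain (2 * D) (w i - w j) :=
      (Finset.single_le_sum (f := fun j => switchGain (2 * D) (w k - w j))
        (fun j _ => switchGain_nonneg _ _) (by simp [hjk] : j ∈ Finset.univ.erase k)).trans
      (Finset.single_le_sum (f := fun i => ∑ j ∈ Finset.univ.erase i,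
        switchGain (2 * D) (w i - w j)) (fun i _ => hpos i) (Finset.mem_univ k))
    have h4 : 2 * D - (w k - w j) ≤ switchGain (2 * D) (w k - w j) := by
      by_cases hm : w k - w j ∈ Set.Icc 0 (2 * D)
      · simp [switchGain, hm]
      · have : 2 * D < w k - w j := by
          by_contra! h
          exact hm ⟨by linarith, h⟩
        linarith [switchGain_nonneg (2 * D) (w k - w j)]
    linarith

theorem abs_apply_le_supNorm {n : ℕ} (d : EuclideanSpace ℝ (Fin n)) (i : Fin n) :
    |d i| ≤ supNorm d :=
  norm_le_pi_norm (WithLp.ofLp d : Fin n → ℝ) i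

theorem supNorm_le_norm {n : ℕ} (d : EuclideanSpace ℝ (Fin n)) : supNorm d ≤ ‖d‖ :=
  (pi_norm_le_iff_of_nonneg (norm_nonneg _)).2 fun i => PiLp.norm_apply_le d i

/-! ### The surplus function: quadratic bounds and gradient. -/

section Surplus

variable {Ω : Type*} [MeasurableSpace Ω] {P : Measure Ω} {n : ℕ}
  {ε : Ω → EuclideanSpace ℝ (Fin n)}

theorem RegularErrors.aemeasurable_apply (hε : RegularErrors P ε) (i : Fin n) :
    AEMeasurable (fun ω => ε ω i) P :=
  (hε.integrable i).1.aemeasurable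

theorem RegularErrors.aemeasurable_shift (hε : RegularErrors P ε)
    (u : EuclideanSpace ℝ (Fin n)) : AEMeasurable (fun ω i => u i + ε ω i) P :=
  aemeasurable_pi_lambda _ fun i => (hε.aemeasurable_apply i).const_add (u i)

theorem surplus_zero [NeZero n] : surplus P ε 0 = ∫ ω, maxCoord (fun i => ε ω i) ∂P := by
  simp [surplus]

variable [IsProbabilityMeasure P] [NeZero n]

theorem RegularErrors.integrable_maxCoord (hε : RegularErrors P ε)
    (u : EuclideanSpace ℝ (Fin n)) :
    Integrable (fun ω => maxCoord fun i => u i + ε ω i) P := by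
  have h : Integrable (fun ω => ∑ i, |u i + ε ω i|) P :=
    integrable_finsetSum _ fun i _ => ((integrable_const (u i)).add (hε.integrable i)).abs
  refine h.mono' (measurable_maxCoord.comp_aemeasurable
    (hε.aemeasurable_shift u)).aestronglyMeasurable (Eventually.of_forall fun ω => ?_)
  exact abs_maxCoord_le _

theorem RegularErrors.apply_le_surplus (hε : RegularErrors P ε)
    (u : EuclideanSpace ℝ (Fin n)) (i : Fin n) : u i ≤ surplus P ε u := by
  have h : ∫ ω, (u i + ε ω i) ∂P = u i := by
    rw [integral_add (integrable_const _) (hε.integrable i), hε.mean_zero i]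
    simp
  rw [← h]
  exact integral_mono ((integrable_const _).add (hε.integrable i)) (hε.integrable_maxCoord u)
    fun ω => le_maxCoord (fun i => u i + ε ω i) i

variable (P ε) in
/-- The probability that each alternative is the (first) maximizer of `u + ε`. -/
def choiceProb (u : EuclideanSpace ℝ (Fin n)) : EuclideanSpace ℝ (Fin n) :=
  WithLp.toLp 2 fun i => ∫ ω, (if argmax (fun j => u j + ε ω j) = i then (1 : ℝ) else 0) ∂P

theorem RegularErrors.integrable_comp_argmax (hε : RegularErrors P ε)
    (u : EuclideanSpace ℝ (Fin n)) (f : Fin n → ℝ) :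
    Integrable (fun ω => f (argmax fun j => u j + ε ω j)) P := by
  refine Integrable.of_bound (C := ∑ i, |f i|) ?_ (Eventually.of_forall fun ω => ?_)
  · exact ((measurable_of_countable f).comp_aemeasurable
      (measurable_argmax.comp_aemeasurable (hε.aemeasurable_shift u))).aestronglyMeasurable
  · exact Finset.single_le_sum (f := fun i => |f i|) (fun _ _ => abs_nonneg _)
      (Finset.mem_univ _)

theorem RegularErrors.sum_choiceProb_mul (hε : RegularErrors P ε)
    (u : EuclideanSpace ℝ (Fin n)) (f : Fin n → ℝ) :
    ∑ i, choiceProb P ε u i * f i = ∫ ω, f (argmax fun j => u j + ε ω j) ∂P := by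
  have h : ∀ i, choiceProb P ε u i * f i =
      ∫ ω, (if argmax (fun j => u j + ε ω j) = i then (1 : ℝ) else 0) * f i ∂P := fun i =>
    (integral_mul_const _ _).symm
  simp_rw [h]
  rw [← integral_finsetSum _ fun i _ => (hε.integrable_comp_argmax u
    fun k => if k = i then (1 : ℝ) else 0).mul_const (f i)]
  simp

theorem RegularErrors.choiceProb_mem_simplex (hε : RegularErrors P ε)
    (u : EuclideanSpace ℝ (Fin n)) : choiceProb P ε u ∈ simplex n := by
  refine ⟨fun i => integral_nonneg fun ω => ?_, ?_⟩
  · dsimp only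
    split_ifs <;> simp
  · simpa using hε.sum_choiceProb_mul u fun _ => 1

theorem inner_eq_sum {n : ℕ} (x y : EuclideanSpace ℝ (Fin n)) :
    inner ℝ x y = ∑ i, x i * y i := by
  simp [PiLp.inner_apply, mul_comm]

theorem RegularErrors.add_inner_le_surplus (hε : RegularErrors P ε)
    (u d : EuclideanSpace ℝ (Fin n)) :
    surplus P ε u + inner ℝ (choiceProb P ε u) d ≤ surplus P ε (u + d) := by
  rw [inner_eq_sum, hε.sum_choiceProb_mul u d, surplus, surplus,
    ← integral_add (hε.integrable_maxCoord u) (hε.integrable_comp_argmax u d)]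
  refine integral_mono ((hε.integrable_maxCoord u).add (hε.integrable_comp_argmax u d))
    (hε.integrable_maxCoord (u + d)) fun ω => ?_
  have h := le_maxCoord (fun i => (u + d) i + ε ω i) (argmax fun j => u j + ε ω j)
  have h' := apply_argmax fun j => u j + ε ω j
  simp only [PiLp.add_apply] at h ⊢
  dsimp only at h'
  linarith

/-- Expectation of `maxCoord_add_le`: each ordered pair contributes at most `g i j (z i j) *
(2D)²/2`, which explains the factor 2 in `smoothConst`. -/
theorem RegularErrors.surplus_add_le (hε : RegularErrors P ε)
    {g : Fin n → Fin n → ℝ → ℝ} {z : Fin n → Fin n → ℝ}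
    (hg : ∀ i j, i ≠ j → IsDensityOf P (fun ω => ε ω j - ε ω i) (g i j))
    (hz : ∀ i j, i ≠ j → IsMode (g i j) (z i j))
    (u d : EuclideanSpace ℝ (Fin n)) {D : ℝ} (hd : supNorm d ≤ D) :
    surplus P ε (u + d) ≤
      surplus P ε u + inner ℝ (choiceProb P ε u) d + smoothConst g z * D ^ 2 := by
  have hD : 0 ≤ D := (norm_nonneg _).trans hd
  have hX : ∀ i j, AEMeasurable (fun ω => ε ω j - ε ω i) P := fun i j =>
    (hε.aemeasurable_apply j).sub (hε.aemeasurable_apply i)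
  have hpair : ∀ i, ∀ j ∈ Finset.univ.erase i,
      Integrable (fun ω => switchGain (2 * D) (u i - u j - (ε ω j - ε ω i))) P := fun i j hj =>
    have hij := (Finset.ne_of_mem_erase hj).symm
    integrable_switchGain_comp (hX i j) (hg i j hij) (hz i j hij) _ _
  have hS : Integrable (fun ω => ∑ i, ∑ j ∈ Finset.univ.erase i,
      switchGain (2 * D) (u i - u j - (ε ω j - ε ω i))) P :=
    integrable_finsetSum _ fun i _ => integrable_finsetSum _ (hpair i)
  have hI : Integrable (fun ω => (maxCoord fun i => u i + ε ω i) +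
      d (argmax fun j => u j + ε ω j)) P :=
    (hε.integrable_maxCoord u).add (hε.integrable_comp_argmax u d)
  have h1 : surplus P ε (u + d) ≤ ∫ ω, ((maxCoord fun i => u i + ε ω i) +
      d (argmax fun j => u j + ε ω j) + ∑ i, ∑ j ∈ Finset.univ.erase i,
        switchGain (2 * D) (u i - u j - (ε ω j - ε ω i))) ∂P := by
    refine integral_mono (hε.integrable_maxCoord (u + d)) (hI.add hS) fun ω => ?_
    have h := maxCoord_add_le (fun i => u i + ε ω i) d
      fun i => (abs_apply_le_supNorm d i).trans hd
    have e1 : (fun i => (u + d) i + ε ω i) = fun i => u i + ε ω i + d i := by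
      ext i
      simp only [PiLp.add_apply]
      ring
    have e2 : ∀ i j, u i + ε ω i - (u j + ε ω j) = u i - u j - (ε ω j - ε ω i) := fun i j => by
      ring
    simp only [e2] at h
    dsimp only
    rw [e1]
    exact h
  refine h1.trans ?_
  rw [integral_add hI hS, integral_add (hε.integrable_maxCoord u)
    (hε.integrable_comp_argmax u d), inner_eq_sum, hε.sum_choiceProb_mul u d,
    integral_finsetSum _ fun i _ => integrable_finsetSum _ (hpair i)]
  refine add_le_add le_rfl ?_
  rw [smoothConst, mul_assoc, Finset.sum_mul, Finset.mul_sum]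
  refine Finset.sum_le_sum fun i _ => ?_
  rw [integral_finsetSum _ (hpair i), Finset.sum_mul, Finset.mul_sum]
  refine Finset.sum_le_sum fun j hj => ?_
  have hij := (Finset.ne_of_mem_erase hj).symm
  refine (integral_switchGain_comp_le (hX i j) (hg i j hij) (hz i j hij)
    (by positivity : 0 ≤ 2 * D) (u i - u j)).trans_eq ?_
  ring

/-- The first-order remainder lies between `0` and `L‖d‖²`, so no differentiation under the integral
is required. -/
theorem RegularErrors.hasGradientAt_surplus (hε : RegularErrors P ε)
    {g : Fin n → Fin n → ℝ → ℝ} {z : Fin n → Fin n → ℝ}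
    (hg : ∀ i j, i ≠ j → IsDensityOf P (fun ω => ε ω j - ε ω i) (g i j))
    (hz : ∀ i j, i ≠ j → IsMode (g i j) (z i j))
    (u : EuclideanSpace ℝ (Fin n)) :
    HasGradientAt (surplus P ε) (choiceProb P ε u) u := by
  rw [hasGradientAt_iff_isLittleO_nhds_zero]
  have h2 : (fun d : EuclideanSpace ℝ (Fin n) => ‖d‖ ^ 2) =o[nhds 0] fun d => d :=
    Asymptotics.isLittleO_norm_pow_id one_lt_two
  refine Asymptotics.IsBigO.trans_isLittleO (Asymptotics.IsBigO.of_bound (smoothConst g z)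
    (Eventually.of_forall fun d => ?_)) h2
  have hlo := hε.add_inner_le_surplus u d
  have hup := hε.surplus_add_le hg hz u d (supNorm_le_norm d)
  rw [Real.norm_of_nonneg (by linarith), Real.norm_of_nonneg (by positivity)]
  linarith

theorem RegularErrors.hasGradientAt_perspective (hε : RegularErrors P ε)
    {g : Fin n → Fin n → ℝ → ℝ} {z : Fin n → Fin n → ℝ}
    (hg : ∀ i j, i ≠ j → IsDensityOf P (fun ω => ε ω j - ε ω i) (g i j))
    (hz : ∀ i j, i ≠ j → IsMode (g i j) (z i j)) {η : ℝ} (hη : 0 < η)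
    (U : EuclideanSpace ℝ (Fin n)) :
    HasGradientAt (perspective (surplus P ε) η) (choiceProb P ε (η⁻¹ • U)) U := by
  have h := (hε.hasGradientAt_surplus hg hz (η⁻¹ • U)).hasFDerivAt
  have h1 := (h.comp U ((hasFDerivAt_id U).const_smul η⁻¹)).const_mul η
  rw [hasGradientAt_iff_hasFDerivAt]
  refine h1.congr_fderiv ?_
  ext v
  simp [mul_inv_cancel_left₀ hη.ne']

/-! ### Decisions and the regret bound. -/

theorem RegularErrors.decision_succ (hε : RegularErrors P ε)
    {g : Fin n → Fin n → ℝ → ℝ} {z : Fin n → Fin n → ℝ}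
    (hg : ∀ i j, i ≠ j → IsDensityOf P (fun ω => ε ω j - ε ω i) (g i j))
    (hz : ∀ i j, i ≠ j → IsMode (g i j) (z i j)) {η : ℝ} (hη : 0 < η)
    (u : ℕ → EuclideanSpace ℝ (Fin n)) (t : ℕ) :
    decision (surplus P ε) η u (t + 1) = choiceProb P ε (η⁻¹ • cumReward u t) :=
  (hε.hasGradientAt_perspective hg hz hη _).gradient

theorem RegularErrors.decision_mem_simplex (hε : RegularErrors P ε)
    {g : Fin n → Fin n → ℝ → ℝ} {z : Fin n → Fin n → ℝ}
    (hg : ∀ i j, i ≠ j → IsDensityOf P (fun ω => ε ω j - ε ω i) (g i j))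
    (hz : ∀ i j, i ≠ j → IsMode (g i j) (z i j)) {η : ℝ} (hη : 0 < η)
    (u : ℕ → EuclideanSpace ℝ (Fin n)) (t : ℕ) :
    decision (surplus P ε) η u t ∈ simplex n := by
  cases t with
  | zero =>
    refine ⟨fun i => ?_, ?_⟩
    · change (0 : ℝ) ≤ 1 / n
      positivity
    · change ∑ _i : Fin n, (1 : ℝ) / n = 1
      simp [NeZero.ne n]
  | succ t =>
    rw [hε.decision_succ hg hz hη]
    exact hε.choiceProb_mem_simplex _

theorem sSup_inner_simplex_le {U : EuclideanSpace ℝ (Fin n)} {c : ℝ} (h : ∀ i, U i ≤ c) :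
    sSup ((fun p => inner ℝ p U) '' simplex n) ≤ c := by
  have hne : (simplex n).Nonempty := by
    refine ⟨EuclideanSpace.single 0 1, fun i => ?_, ?_⟩
    · rw [PiLp.single_apply]
      split_ifs <;> simp
    · simp
  refine csSup_le (hne.image _) ?_
  rintro _ ⟨p, hp, rfl⟩
  dsimp only
  rw [inner_eq_sum]
  calc ∑ i, p i * U i ≤ ∑ i, p i * c :=
        Finset.sum_le_sum fun i _ => mul_le_mul_of_nonneg_left (h i) (hp.1 i)
    _ = c := by rw [← Finset.sum_mul, hp.2, one_mul]

/-- Telescoping: each round applies `surplus_add_le` to the increment `η⁻¹ • u_t`, of sup norm at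
most `K/η`. -/
theorem RegularErrors.perspective_cumReward_le (hε : RegularErrors P ε)
    {g : Fin n → Fin n → ℝ → ℝ} {z : Fin n → Fin n → ℝ}
    (hg : ∀ i j, i ≠ j → IsDensityOf P (fun ω => ε ω j - ε ω i) (g i j))
    (hz : ∀ i j, i ≠ j → IsMode (g i j) (z i j)) {η : ℝ} (hη : 0 < η) {K : ℝ}
    (u : ℕ → EuclideanSpace ℝ (Fin n)) (T : ℕ) (hu : BoundedRewards K T u) :
    perspective (surplus P ε) η (cumReward u T) ≤ η * surplus P ε 0
      + ∑ t ∈ Finset.Icc 1 T, inner ℝ (decision (surplus P ε) η u t) (u t)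
      + smoothConst g z * K ^ 2 * T / η := by
  induction T with
  | zero => simp [perspective, cumReward]
  | succ T ih =>
    have ih' := ih fun t ht => hu t (Finset.Icc_subset_Icc_right T.le_succ ht)
    have hK : supNorm (u (T + 1)) ≤ K := hu _ (by simp)
    have hd : supNorm (η⁻¹ • u (T + 1)) ≤ η⁻¹ * K := by
      have : supNorm (η⁻¹ • u (T + 1)) = η⁻¹ * supNorm (u (T + 1)) := by
        rw [supNorm, WithLp.ofLp_smul, norm_smul, Real.norm_of_nonneg (by positivity), supNorm]
      rw [this]
      gcongr
    have h := mul_le_mul_of_nonneg_left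
      (hε.surplus_add_le hg hz (η⁻¹ • cumReward u T) _ hd) hη.le
    rw [← smul_add, real_inner_smul_right, ← hε.decision_succ hg hz hη] at h
    rw [Finset.sum_Icc_succ_top (by omega)]
    have e1 : η * (surplus P ε (η⁻¹ • cumReward u T)
        + η⁻¹ * inner ℝ (decision (surplus P ε) η u (T + 1)) (u (T + 1))
        + smoothConst g z * (η⁻¹ * K) ^ 2) = perspective (surplus P ε) η (cumReward u T)
        + inner ℝ (decision (surplus P ε) η u (T + 1)) (u (T + 1))
        + smoothConst g z * K ^ 2 / η := by
      rw [perspective]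
      field_simp
    have e2 : smoothConst g z * K ^ 2 * ((T + 1 : ℕ) : ℝ) / η =
        smoothConst g z * K ^ 2 * T / η + smoothConst g z * K ^ 2 / η := by
      push_cast
      ring
    rw [e1] at h
    rw [e2]
    change η * surplus P ε (η⁻¹ • (cumReward u T + u (T + 1))) ≤ _
    linarith

theorem RegularErrors.regret_le (hε : RegularErrors P ε)
    {g : Fin n → Fin n → ℝ → ℝ} {z : Fin n → Fin n → ℝ}
    (hg : ∀ i j, i ≠ j → IsDensityOf P (fun ω => ε ω j - ε ω i) (g i j))
    (hz : ∀ i j, i ≠ j → IsMode (g i j) (z i j)) {η : ℝ} (hη : 0 < η) {K : ℝ}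
    (u : ℕ → EuclideanSpace ℝ (Fin n)) (T : ℕ) (hu : BoundedRewards K T u) :
    regret (decision (surplus P ε) η u) u T ≤
      η * surplus P ε 0 + smoothConst g z * K ^ 2 * T / η := by
  have h1 := hε.perspective_cumReward_le hg hz hη u T hu
  have h2 : ∀ i, cumReward u T i ≤ perspective (surplus P ε) η (cumReward u T) := fun i => by
    have h := mul_le_mul_of_nonneg_left (hε.apply_le_surplus (η⁻¹ • cumReward u T) i) hη.le
    rwa [PiLp.smul_apply, smul_eq_mul, mul_inv_cancel_left₀ hη.ne'] at h
  have h3 := sSup_inner_simplex_le h2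
  rw [regret]
  linarith

/-! ### Positivity of the constants and choice of the step size. -/

/-- If `E(0) = 0`, every error equals the maximum almost surely, so the difference has an atom at
`0`, which a density forbids. -/
theorem RegularErrors.surplus_zero_pos (hε : RegularErrors P ε) {i j : Fin n} {f : ℝ → ℝ}
    (hf : IsDensityOf P (fun ω => ε ω j - ε ω i) f) : 0 < surplus P ε 0 := by
  have h0 : ∀ k, 0 ≤ surplus P ε 0 := fun k => hε.apply_le_surplus 0 k
  refine lt_of_le_of_ne (h0 i) fun h => ?_
  have hint : Integrable (fun ω => maxCoord fun i => ε ω i) P := by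
    simpa using hε.integrable_maxCoord 0
  have hae : ∀ k, ∀ᵐ ω ∂P, maxCoord (fun i => ε ω i) = ε ω k := fun k => by
    have hz : ∫ ω, (maxCoord (fun i => ε ω i) - ε ω k) ∂P = 0 := by
      rw [integral_sub hint (hε.integrable k), hε.mean_zero k, ← surplus_zero, ← h, sub_zero]
    have := (integral_eq_zero_iff_of_nonneg
      (fun ω => sub_nonneg.2 (le_maxCoord (fun i => ε ω i) k)) (hint.sub (hε.integrable k))).1 hz
    filter_upwards [this] with ω hω
    exact sub_eq_zero.1 hω
  have hX : AEMeasurable (fun ω => ε ω j - ε ω i) P :=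
    (hε.aemeasurable_apply j).sub (hε.aemeasurable_apply i)
  have hone : P.map (fun ω => ε ω j - ε ω i) {0} = 1 := by
    rw [Measure.map_apply_of_aemeasurable hX (measurableSet_singleton 0)]
    refine (measure_congr (eventuallyEq_univ.2 ?_)).trans measure_univ
    filter_upwards [hae i, hae j] with ω h1 h2
    simp [← h1, ← h2]
  rw [hf.map_eq, withDensity_absolutelyContinuous _ _ (by simp)] at hone
  exact zero_ne_one hone

end Surplus

theorem smoothConst_nonneg {Ω : Type*} [MeasurableSpace Ω] {P : Measure Ω} {n : ℕ}
    {ε : Ω → EuclideanSpace ℝ (Fin n)} {g : Fin n → Fin n → ℝ → ℝ} (z : Fin n → Fin n → ℝ)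
    (hg : ∀ i j, i ≠ j → IsDensityOf P (fun ω => ε ω j - ε ω i) (g i j)) :
    0 ≤ smoothConst g z :=
  mul_nonneg zero_le_two <| Finset.sum_nonneg fun i _ => Finset.sum_nonneg fun j hj =>
    (hg i j (Finset.ne_of_mem_erase hj).symm).nonneg _

/-- A density that vanishes at its mode has total mass zero. -/
theorem IsDensityOf.pos_of_isMode {Ω : Type*} [MeasurableSpace Ω] {P : Measure Ω}
    [IsProbabilityMeasure P] {X : Ω → ℝ} (hX : AEMeasurable X P) {g : ℝ → ℝ} {z : ℝ}
    (hg : IsDensityOf P X g) (hz : IsMode g z) : 0 < g z := by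
  refine lt_of_le_of_ne (hg.nonneg z) fun h => ?_
  have h1 := map_le_smul_volume hg hz Set.univ
  have h2 := (Measure.isProbabilityMeasure_map hX).measure_univ
  rw [h2, ← h] at h1
  simp at h1

theorem smoothConst_pos {Ω : Type*} [MeasurableSpace Ω] {P : Measure Ω} [IsProbabilityMeasure P]
    {n : ℕ} {ε : Ω → EuclideanSpace ℝ (Fin n)} (hε : RegularErrors P ε)
    {g : Fin n → Fin n → ℝ → ℝ} {z : Fin n → Fin n → ℝ}
    (hg : ∀ i j, i ≠ j → IsDensityOf P (fun ω => ε ω j - ε ω i) (g i j))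
    (hz : ∀ i j, i ≠ j → IsMode (g i j) (z i j)) (hn : 2 ≤ n) : 0 < smoothConst g z := by
  have hpos : ∀ i, ∀ j ∈ Finset.univ.erase i, 0 < g i j (z i j) := fun i j hj =>
    have hij := (Finset.ne_of_mem_erase hj).symm
    (hg i j hij).pos_of_isMode
      ((hε.aemeasurable_apply j).sub (hε.aemeasurable_apply i)) (hz i j hij)
  have : Nontrivial (Fin n) := Fin.nontrivial_iff_two_le.2 hn
  refine mul_pos zero_lt_two (Finset.sum_pos (fun i _ => Finset.sum_pos (hpos i) ?_)
    ⟨⟨0, by omega⟩, Finset.mem_univ _⟩)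
  obtain ⟨j, hj⟩ := exists_ne i
  exact ⟨j, by simp [hj]⟩

theorem regret_nonpos_of_boundedRewards_zero {n : ℕ} [NeZero n]
    (x u : ℕ → EuclideanSpace ℝ (Fin n)) (T : ℕ) (hu : BoundedRewards 0 T u) :
    regret x u T ≤ 0 := by
  have h0 : ∀ t ∈ Finset.Icc 1 T, u t = 0 := fun t ht => by
    ext i
    exact abs_nonpos_iff.1 ((abs_apply_le_supNorm _ i).trans (hu t ht))
  have hU : ∀ t ≤ T, cumReward u t = 0 := by
    intro t
    induction t with
    | zero => exact fun _ => rfl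
    | succ t ih =>
      intro ht
      rw [cumReward, ih (by omega), h0 _ (Finset.mem_Icc.2 ⟨by omega, ht⟩), add_zero]
  have hs : ∑ t ∈ Finset.Icc 1 T, inner ℝ (x t) (u t) = 0 :=
    Finset.sum_eq_zero fun t ht => by rw [h0 t ht, inner_zero_right]
  rw [regret, hs, hU T le_rfl, sub_zero]
  exact sSup_inner_simplex_le fun i => le_rfl

theorem optimal_stepSize {a c K : ℝ} (ha : 0 < a) (hc : 0 < c) (hK : 0 < K) :
    K * √(c / a) * a + c * K ^ 2 / (K * √(c / a)) = 2 * √(a * c) * K := by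
  have hs : √(c / a) = √c / √a := Real.sqrt_div hc.le a
  have hm : √(a * c) = √a * √c := Real.sqrt_mul ha.le c
  have ha' : 0 < √a := Real.sqrt_pos.2 ha
  have hc' : 0 < √c := Real.sqrt_pos.2 hc
  rw [hs, hm]
  have h1 : √a ^ 2 = a := Real.sq_sqrt ha.le
  have h2 : √c ^ 2 = c := Real.sq_sqrt hc.le
  generalize √a = p at *
  generalize √c = q at *
  subst h1 h2
  field_simp
  ring

theorem two_mul_sqrt_mul_le {a c K s : ℝ} (ha : 0 < a) (hc : 0 < c) (hs : 0 < s) :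
    2 * √(a * c) * K ≤ s * a + c * K ^ 2 / s := by
  have h1 : √a ^ 2 = a := Real.sq_sqrt ha.le
  have h2 : √c ^ 2 = c := Real.sq_sqrt hc.le
  rw [Real.sqrt_mul ha.le c]
  generalize √a = p at *
  generalize √c = q at *
  subst h1 h2
  have h : s * p ^ 2 + q ^ 2 * K ^ 2 / s - 2 * (p * q) * K = (s * p - q * K) ^ 2 / s := by
    field_simp
    ring
  have : 0 ≤ (s * p - q * K) ^ 2 / s := by positivity
  linarith

theorem eventually_sqrt_mul_div_le (c K : ℝ) {δ : ℝ} (hδ : 0 < δ) :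
    ∀ᶠ T : ℕ in atTop, 2 * √(c * T) * K / T ≤ δ := by
  have h1 : Tendsto (fun T : ℕ => (√(T : ℝ))⁻¹) atTop (nhds 0) :=
    (Real.tendsto_sqrt_atTop.comp tendsto_natCast_atTop_atTop).inv_tendsto_atTop
  have h2 := h1.const_mul (2 * √c * K)
  rw [mul_zero] at h2
  filter_upwards [h2.eventually_le_const hδ] with T hT
  refine le_trans (le_of_eq ?_) hT
  rw [Real.sqrt_mul' c T.cast_nonneg, ← Real.sqrt_div_self]
  ring

end RUMExperts

end

theorem mainTheorem1
    {Ω : Type*} [MeasurableSpace Ω] (P : Measure Ω) [IsProbabilityMeasure P]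
    (n : ℕ) [NeZero n]
    (ε : Ω → EuclideanSpace ℝ (Fin n)) (hε : RUMExperts.RegularErrors P ε)
    (g : Fin n → Fin n → ℝ → ℝ) (z : Fin n → Fin n → ℝ)
    (hg : ∀ i j, i ≠ j → RUMExperts.IsDensityOf P (fun ω => ε ω j - ε ω i) (g i j))
    (hz : ∀ i j, i ≠ j → RUMExperts.IsMode (g i j) (z i j))
    (α : ℝ) (hα : ∫ ω, RUMExperts.maxCoord (fun i => ε ω i) ∂P ≤ α)
    (K : ℝ) (hK : 0 ≤ K) (L : ℝ) (hL : L = RUMExperts.smoothConst g z) :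
    -- the algorithm is well defined
    Differentiable ℝ (RUMExperts.surplus P ε) ∧
    (∀ η : ℝ, 0 < η → ∀ u : ℕ → EuclideanSpace ℝ (Fin n), ∀ t : ℕ,
      RUMExperts.decision (RUMExperts.surplus P ε) η u t ∈ RUMExperts.simplex n) ∧
    -- the regret bound for every step size
    (∀ T : ℕ, 1 ≤ T → ∀ η : ℝ, 0 < η → ∀ u : ℕ → EuclideanSpace ℝ (Fin n),
      RUMExperts.BoundedRewards K T u →
      RUMExperts.regret (RUMExperts.decision (RUMExperts.surplus P ε) η u) u T
        ≤ η * α + L * K ^ 2 * T / η) ∧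
    -- the regret bound for the optimized step size, which depends on the horizon
    ∃ η : ℕ → ℝ, (∀ T : ℕ, 1 ≤ T → 0 < η T) ∧
      (2 ≤ n → 0 < K → ∀ T : ℕ, 1 ≤ T → η T = K * √(L * T / α) ∧
        IsMinOn (fun s : ℝ => s * α + L * K ^ 2 * T / s) (Set.Ioi 0) (η T)) ∧
      (∀ T : ℕ, 1 ≤ T → ∀ u : ℕ → EuclideanSpace ℝ (Fin n),
        RUMExperts.BoundedRewards K T u →
        RUMExperts.regret (RUMExperts.decision (RUMExperts.surplus P ε) (η T) u) u T
          ≤ 2 * √(α * L * T) * K) ∧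
      -- the average regret vanishes
      (∀ δ : ℝ, 0 < δ → ∀ᶠ T : ℕ in atTop, ∀ u : ℕ → EuclideanSpace ℝ (Fin n),
        RUMExperts.BoundedRewards K T u →
        RUMExperts.regret (RUMExperts.decision (RUMExperts.surplus P ε) (η T) u) u T / T
          ≤ δ) := by
  subst hL
  rw [← RUMExperts.surplus_zero] at hα
  have hL0 := RUMExperts.smoothConst_nonneg z hg
  have hbound : ∀ T : ℕ, 1 ≤ T → ∀ η : ℝ, 0 < η → ∀ u : ℕ → EuclideanSpace ℝ (Fin n),
      RUMExperts.BoundedRewards K T u →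
      RUMExperts.regret (RUMExperts.decision (RUMExperts.surplus P ε) η u) u T
        ≤ η * α + RUMExperts.smoothConst g z * K ^ 2 * T / η := fun T _ η hη u hu =>
    (hε.regret_le hg hz hη u T hu).trans <| by gcongr
  refine ⟨fun u => (hε.hasGradientAt_surplus hg hz u).differentiableAt,
    fun η hη u t => hε.decision_mem_simplex hg hz hη u t, hbound, ?_⟩
  suffices h : ∃ η : ℕ → ℝ, (∀ T : ℕ, 1 ≤ T → 0 < η T) ∧
      (2 ≤ n → 0 < K → ∀ T : ℕ, 1 ≤ T → η T = K * √(RUMExperts.smoothConst g z * T / α) ∧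
        IsMinOn (fun s : ℝ => s * α + RUMExperts.smoothConst g z * K ^ 2 * T / s)
          (Set.Ioi 0) (η T)) ∧
      (∀ T : ℕ, 1 ≤ T → ∀ u : ℕ → EuclideanSpace ℝ (Fin n),
        RUMExperts.BoundedRewards K T u →
        RUMExperts.regret (RUMExperts.decision (RUMExperts.surplus P ε) (η T) u) u T
          ≤ 2 * √(α * RUMExperts.smoothConst g z * T) * K) by
    obtain ⟨η, h1, h2, h3⟩ := h
    refine ⟨η, h1, h2, h3, fun δ hδ => ?_⟩
    -- The threshold depends only on `α`, `L`, `K`, `δ`, hence is uniform over reward sequences.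
    filter_upwards [RUMExperts.eventually_sqrt_mul_div_le
      (α * RUMExperts.smoothConst g z) K hδ, eventually_ge_atTop 1] with T hT hT1 u hu
    exact (div_le_div_of_nonneg_right (h3 T hT1 u hu) T.cast_nonneg).trans hT
  -- If `n = 1` (where `L = 0`) or `K = 0`, the formula for `η_T` gives zero, so the step size `1`
  -- is used instead; the regret is then nonpositive.
  by_cases hcase : 2 ≤ n ∧ 0 < K
  · obtain ⟨hn, hK0⟩ := hcase
    have hLpos := RUMExperts.smoothConst_pos hε hg hz hn
    have hαpos : 0 < α := (hε.surplus_zero_pos (hg ⟨0, by omega⟩ ⟨1, by omega⟩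
      (by simp))).trans_le hα
    have hc : ∀ T : ℕ, 1 ≤ T → 0 < RUMExperts.smoothConst g z * T := fun T hT =>
      mul_pos hLpos (by exact_mod_cast hT)
    have hη : ∀ T : ℕ, 1 ≤ T → 0 < K * √(RUMExperts.smoothConst g z * T / α) := fun T hT =>
      mul_pos hK0 (Real.sqrt_pos.2 (div_pos (hc T hT) hαpos))
    have hopt := fun (T : ℕ) (hT : 1 ≤ T) => RUMExperts.optimal_stepSize hαpos (hc T hT) hK0
    refine ⟨_, hη, fun _ _ T hT => ⟨rfl, fun s hs => ?_⟩, fun T hT u hu => ?_⟩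
    · have h := RUMExperts.two_mul_sqrt_mul_le (K := K) hαpos (hc T hT) hs
      rw [← hopt T hT] at h
      simpa only [Set.mem_ofPred_eq, mul_right_comm _ (K ^ 2) (T : ℝ)] using h
    · have h := hbound T hT _ (hη T hT) u hu
      rwa [mul_right_comm _ (K ^ 2) (T : ℝ), hopt T hT, ← mul_assoc] at h
  · refine ⟨fun _ => 1, fun _ _ => one_pos, fun hn hK0 => absurd ⟨hn, hK0⟩ hcase,
      fun T _ u hu => le_trans ?_ (by positivity)⟩
    rcases hK.eq_or_lt with rfl | hK0
    · exact RUMExperts.regret_nonpos_of_boundedRewards_zero _ u T hu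
    · obtain rfl : n = 1 := by
        have := NeZero.ne n
        by_contra h
        exact hcase ⟨by omega, hK0⟩
      have h := hε.regret_le hg hz one_pos u T hu
      have hs : RUMExperts.surplus P ε 0 = 0 := by
        simpa [RUMExperts.surplus, RUMExperts.maxCoord] using hε.mean_zero 0
      have hL1 : RUMExperts.smoothConst g z = 0 := by
        simp [RUMExperts.smoothConst]
      simpa [hs, hL1] using h
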